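/- Let $n\ge 1$, let $U\subset\mathbb{R}^n$ be an open set containing the origin, and let $$g=g_{nn}(x)\,dx_n^2+2b_j(x)\,dx_j\,dx_n+g_{kl}(x)\,dx_k\,dx_l$$ be a possibly degenerate analytic Riemannian metric on $U$: its components are real-analytic on $U$, and the symmetric matrix of $g$ is positive semidefinite at every point of $U$ (for instance positive definite on $U\setminus\{0\}$). Here Latin indices run from $1$ to $n-1$, and repeated indices are summed. Suppose that $g_{nn}(0)=0$, that this zero of $g_{nn}$ is isolated, and that $\det(g_{kl})\neq 0$ at every point of $U$. Then there are an open neighbourhood $V$ of the origin and an analytic map $f=(f_1,\dots,f_{n-1}):V\to\mathbb{R}^{n-1}$ such that the map $\Phi$ given on $V$ by $$x_n=\bar x_n,\qquad x_j=\bar x_j+f_j(\bar x)\quad(1\le j\le n-1)$$ satisfies $\Phi(0)=0$, is an analytic diffeomorphism, with analytic inverse, from $V$ onto an open subset of $U$, and such that the pullback $\bar g=\Phi^*g$ has no cross terms, that is, on all of $V$, $$\bar g=\bar g_{nn}(\bar x)\,d\bar x_n^2+\bar g_{kl}(\bar x)\,d\bar x_k\,d\bar x_l .$$ -/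

import Mathlib

open scoped Matrix Topology

/-- A field of `n × n` matrices on `ℝⁿ`, `n = m + 1`: the components `g_{αβ}(x)` of a bilinear form
`g = g_{αβ}(x) dx_α dx_β`. The distinguished coordinate `x_n` has the index `Fin.last m`; the
remaining coordinates `x_j`, `1 ≤ j ≤ n - 1`, have the indices `j.castSucc` with `j : Fin m`.
(Nothing below depends on the choice of a norm on `ℝⁿ`.) -/
abbrev TensorField (m : ℕ) : Type :=
  (Fin (m + 1) → ℝ) → Matrix (Fin (m + 1)) (Fin (m + 1)) ℝ

/-- The block `(g_{kl})`, `1 ≤ k, l ≤ n - 1`, of the matrix `(g_{αβ})`. -/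
def tangentialBlock {m : ℕ} (G : Matrix (Fin (m + 1)) (Fin (m + 1)) ℝ) :
    Matrix (Fin m) (Fin m) ℝ :=
  G.submatrix Fin.castSucc Fin.castSucc

/-- Analytic Riemannian metrics on `U`, possibly degenerate, that are singular at the origin:
`g_nn` has an isolated zero at `0`, and `det (g_{kl}) ≠ 0` in `U`. The matrix `g x` is only required
to be symmetric and positive semidefinite, which allows it to be positive definite at every point
of `U` other than the origin, and degenerate at the origin. -/
structure IsSingularRiemannianMetric {m : ℕ} (U : Set (Fin (m + 1) → ℝ)) (g : TensorField m) :
    Prop where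
  analytic : ∀ α β, AnalyticOnNhd ℝ (fun x => g x α β) U
  posSemidef : ∀ x ∈ U, (g x).PosSemidef
  normal_zero : g 0 (Fin.last m) (Fin.last m) = 0
  normal_isolated : ∀ᶠ x in 𝓝[≠] (0 : Fin (m + 1) → ℝ), g x (Fin.last m) (Fin.last m) ≠ 0
  det_ne_zero : ∀ x ∈ U, (tangentialBlock (g x)).det ≠ 0

/-- The Jacobian matrix `(∂Φ_α / ∂x̄_β)` of a map `Φ` at `x̄`. -/
noncomputable def jacobianMatrix {m : ℕ} (Φ : (Fin (m + 1) → ℝ) → (Fin (m + 1) → ℝ))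
    (x : Fin (m + 1) → ℝ) : Matrix (Fin (m + 1)) (Fin (m + 1)) ℝ :=
  Matrix.of fun α β => fderiv ℝ Φ x (Pi.single β 1) α

/-- The pullback `Φ^* g`, in components
`ḡ_{αβ}(x̄) = g_{γδ}(Φ(x̄)) (∂Φ_γ / ∂x̄_α) (∂Φ_δ / ∂x̄_β)`. -/
noncomputable def pullbackTensor {m : ℕ} (Φ : (Fin (m + 1) → ℝ) → (Fin (m + 1) → ℝ))
    (g : TensorField m) : TensorField m :=
  fun x => (jacobianMatrix Φ x)ᵀ * g (Φ x) * jacobianMatrix Φ x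

/-- No cross terms: `G_{jn} = G_{nj} = 0` for `1 ≤ j ≤ n - 1`, so that the bilinear form is
`G_nn dx_n² + G_{kl} dx_k dx_l`. -/
def HasNoCrossTerms {m : ℕ} (G : Matrix (Fin (m + 1)) (Fin (m + 1)) ℝ) : Prop :=
  ∀ j : Fin m, G j.castSucc (Fin.last m) = 0 ∧ G (Fin.last m) j.castSucc = 0

/-! ### Analytic dependence of integral curves on time and initial value -/

section

open scoped ContDiff

variable {K E F : Type*} [TopologicalSpace K] [CompactSpace K]
  [NormedAddCommGroup E] [NormedSpace ℝ E] [NormedAddCommGroup F] [NormedSpace ℝ F]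

/-! Since (g_kl) is invertible, there is a unique vector field X with last component 1 that is
g-orthogonal to the slices x_n = const, and it is analytic by Cramer's rule. Let Φ send (x', t) to
the point that the flow of X reaches at time t from (x', 0). Then ∂Φ/∂x_n = X∘Φ, while Φ preserves
x_n, so the other columns of its Jacobian are tangent to the slices; orthogonality kills the cross
terms (`hasNoCrossTerms_transpose_mul_mul`). As Φ is the identity on x_n = 0 and preserves x_n, its
derivative at 0 is injective (`AnalyticAt.exists_straightening`), and the inverse function theorem
applies. Joint analyticity of the flow comes from the implicit function theorem in C([0,1], E) for
γ(s) = y + t ∫₀ˢ X(γ) (`AnalyticAt.exists_analytic_integral_curve`). -/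

/-- The multilinear map on continuous functions given by applying a continuous multilinear map
pointwise. -/
noncomputable def ContinuousMultilinearMap.pointwise (K : Type*) [TopologicalSpace K]
    [CompactSpace K] {n : ℕ}
    (p : ContinuousMultilinearMap ℝ (fun _ : Fin n => E) F) :
    ContinuousMultilinearMap ℝ (fun _ : Fin n => C(K, E)) C(K, F) :=
  MultilinearMap.mkContinuous
    { toFun := fun u => ⟨fun s => p fun i => u i s, by fun_prop⟩
      map_update_add' := by
        intro inst u i a b
        have h : inst = instDecidableEqFin n := Subsingleton.elim _ _
        subst h
        ext s
        have h : ∀ c : C(K, E), (fun j => Function.update u i c j s)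
            = Function.update (fun j => u j s) i (c s) := by
          intro c; ext j; by_cases hj : j = i
          · subst hj; simp
          · simp [hj]
        simp [h]
      map_update_smul' := by
        intro inst u i a b
        have h : inst = instDecidableEqFin n := Subsingleton.elim _ _
        subst h
        ext s
        have h : ∀ c : C(K, E), (fun j => Function.update u i c j s)
            = Function.update (fun j => u j s) i (c s) := by
          intro c; ext j; by_cases hj : j = i
          · subst hj; simp
          · simp [hj]
        simp [h] } ‖p‖ (by
    intro u
    refine (ContinuousMap.norm_le _ (by positivity)).2 fun s => ?_
    refine (p.le_opNorm _).trans ?_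
    gcongr with i
    exact (u i).norm_coe_le_norm s)

theorem ContinuousMultilinearMap.norm_pointwise_le {n : ℕ}
    (p : ContinuousMultilinearMap ℝ (fun _ : Fin n => E) F) : ‖p.pointwise K‖ ≤ ‖p‖ :=
  MultilinearMap.mkContinuous_norm_le _ (norm_nonneg _) _

/-- Composition with an analytic function is analytic on spaces of continuous functions. -/
theorem AnalyticAt.exists_comp_continuousMap [CompleteSpace F] {X : E → F}
    (hX : AnalyticAt ℝ X 0) :
    ∃ N : C(K, E) → C(K, F), AnalyticAt ℝ N 0 ∧
      ∃ r > 0, ∀ u : C(K, E), ‖u‖ < r → ∀ s, N u s = X (u s) := by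
  obtain ⟨p, R, hp⟩ := hX
  let q : FormalMultilinearSeries ℝ C(K, E) C(K, F) := fun n => (p n).pointwise K
  have hrad : p.radius ≤ q.radius := by
    refine ENNReal.le_of_forall_nnreal_lt fun r hr => ?_
    refine q.le_radius_of_summable_norm ?_
    refine Summable.of_nonneg_of_le (fun _ => by positivity) (fun n => ?_)
      (p.summable_norm_mul_pow hr)
    gcongr
    exact (p n).norm_pointwise_le
  have hq := q.hasFPowerSeriesOnBall ((hp.r_pos.trans_le hp.r_le).trans_le hrad)
  obtain ⟨r, hr0, hr⟩ := ENNReal.lt_iff_exists_nnreal_btwn.1 hp.r_pos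
  refine ⟨q.sum, hq.analyticAt, r, by exact_mod_cast hr0, fun u hu s => ?_⟩
  have hur : ‖u‖ₑ < R := lt_trans (by
    rw [← ofReal_norm]
    exact (ENNReal.ofReal_lt_coe_iff (by positivity)).2 hu) hr
  have h1 := hq.hasSum (y := u) (by
    simpa using lt_of_lt_of_le hur (hp.r_le.trans hrad))
  -- Evaluation at `s` turns the series in C(K, F) into the power series of `X` at `u s`.
  have h2 := (ContinuousMap.evalCLM ℝ s : C(K, F) →L[ℝ] F).hasSum h1
  have h3 := hp.hasSum (y := u s) (by
    have : ‖u s‖ₑ ≤ ‖u‖ₑ := by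
      simpa [enorm_le_iff_norm_le] using u.norm_coe_le_norm s
    simpa using lt_of_le_of_lt this hur)
  simp only [zero_add] at h2 h3
  exact h2.unique h3

/-- The primitive vanishing at `0` of a continuous function on the unit interval. -/
noncomputable def unitInterval.primitive (E : Type*) [NormedAddCommGroup E] [NormedSpace ℝ E] :
    C(unitInterval, E) →L[ℝ] C(unitInterval, E) :=
  LinearMap.mkContinuous
    { toFun := fun u => ⟨fun s => ∫ t in (0 : ℝ)..s, u (Set.projIcc 0 1 zero_le_one t),
        (intervalIntegral.continuous_primitive (fun a b => Continuous.intervalIntegrable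
          (u.continuous.comp continuous_projIcc) a b) 0).comp continuous_subtype_val⟩
      map_add' := by
        intro u v
        ext s
        exact intervalIntegral.integral_add
          (Continuous.intervalIntegrable (u.continuous.comp continuous_projIcc) _ _)
          (Continuous.intervalIntegrable (v.continuous.comp continuous_projIcc) _ _)
      map_smul' := by
        intro c u
        ext s
        exact intervalIntegral.integral_smul _ _ } 1 (by
    intro u
    refine (ContinuousMap.norm_le _ (by positivity)).2 fun s => ?_
    refine (intervalIntegral.norm_integral_le_of_norm_le_const
      (fun t _ => u.norm_coe_le_norm _)).trans ?_
    rw [sub_zero, abs_of_nonneg s.2.1, one_mul]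
    exact mul_le_of_le_one_right (norm_nonneg _) s.2.2)

theorem unitInterval.primitive_apply (u : C(unitInterval, E)) (s : unitInterval) :
    unitInterval.primitive E u s = ∫ t in (0 : ℝ)..s, u (Set.projIcc 0 1 zero_le_one t) := rfl

/-- For an analytic vector field `X`, curves `γ` on the unit interval with
`γ s = y + t ∫₀ˢ X (γ σ) dσ` exist, are unique, and depend analytically on `t` and `y`, when
`t`, `y` and `γ` are small. -/
theorem AnalyticAt.exists_analytic_integral_curve [CompleteSpace E] {X : E → E}
    (hX : AnalyticAt ℝ X 0) :
    ∃ ψ : ℝ × E → C(unitInterval, E), AnalyticAt ℝ ψ 0 ∧ ψ 0 = 0 ∧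
      ∀ᶠ v : (ℝ × E) × C(unitInterval, E) in 𝓝 0,
        (∀ s : unitInterval, v.2 s = v.1.2 + v.1.1 • ∫ t in (0 : ℝ)..s,
          X (v.2 (Set.projIcc 0 1 zero_le_one t))) ↔ ψ v.1 = v.2 := by
  obtain ⟨N, hN, r, hr, hNX⟩ := hX.exists_comp_continuousMap (K := unitInterval)
  let G : (ℝ × E) × C(unitInterval, E) → C(unitInterval, E) := fun v =>
    v.2 - (ContinuousLinearMap.const (R := ℝ) unitInterval v.1.2
      + v.1.1 • unitInterval.primitive E (N v.2))
  have hNs : AnalyticAt ℝ (fun v : (ℝ × E) × C(unitInterval, E) => N v.2) 0 :=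
    AnalyticAt.comp (g := N) (f := Prod.snd) hN analyticAt_snd
  have hJN : AnalyticAt ℝ
      (fun v : (ℝ × E) × C(unitInterval, E) => unitInterval.primitive E (N v.2)) 0 :=
    ((unitInterval.primitive E).analyticAt _).comp hNs
  have hfst : AnalyticAt ℝ (fun v : (ℝ × E) × C(unitInterval, E) => v.1.1) 0 :=
    ((ContinuousLinearMap.fst ℝ ℝ E).comp
      (ContinuousLinearMap.fst ℝ (ℝ × E) C(unitInterval, E))).analyticAt 0
  have hconst : AnalyticAt ℝ (fun v : (ℝ × E) × C(unitInterval, E) =>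
      ContinuousLinearMap.const (R := ℝ) unitInterval v.1.2) 0 :=
    ((ContinuousLinearMap.const (R := ℝ) unitInterval).comp
      ((ContinuousLinearMap.snd ℝ ℝ E).comp
        (ContinuousLinearMap.fst ℝ (ℝ × E) C(unitInterval, E)))).analyticAt 0
  have hG : AnalyticAt ℝ G 0 := analyticAt_snd.sub (hconst.add (hfst.smul hJN))
  have hG0 : G 0 = 0 := by simp [G]
  have hcd : ContDiffAt ℝ ω G 0 := hG.contDiffAt
  -- At t = 0 the integral term vanishes, so the partial derivative in γ is the identity.
  have hinv : (fderiv ℝ G 0 ∘L .inr ℝ (ℝ × E) C(unitInterval, E)).IsInvertible := by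
    have h1 : HasFDerivAt (fun γ : C(unitInterval, E) => G (0, γ))
        (fderiv ℝ G 0 ∘L .inr ℝ (ℝ × E) C(unitInterval, E)) 0 :=
      HasFDerivAt.comp (g := G) (0 : C(unitInterval, E)) hG.differentiableAt.hasFDerivAt
        (ContinuousLinearMap.inr ℝ (ℝ × E) C(unitInterval, E)).hasFDerivAt
    have h2 : (fun γ : C(unitInterval, E) => G (0, γ)) = id := by
      ext γ; simp [G]
    rw [h2] at h1
    rw [h1.unique (hasFDerivAt_id _)]
    exact ⟨ContinuousLinearEquiv.refl ℝ _, rfl⟩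
  refine ⟨hcd.implicitFunction (by simp) hinv,
    (hcd.contDiffAt_implicitFunction (by simp) hinv).analyticAt,
    hcd.implicitFunction_apply_self (by simp) hinv, ?_⟩
  have hsmall : ∀ᶠ v : (ℝ × E) × C(unitInterval, E) in 𝓝 0, ‖v.2‖ < r :=
    (continuous_snd.norm.tendsto' _ _ (by simp)).eventually (gt_mem_nhds hr)
  filter_upwards [hcd.eventually_apply_eq_iff_implicitFunction (by simp) hinv, hsmall]
    with v hv hvr
  rw [← hv, hG0, sub_eq_zero, ContinuousMap.ext_iff]
  refine forall_congr' fun s => ?_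
  have : unitInterval.primitive E (N v.2) s
      = ∫ t in (0 : ℝ)..s, X (v.2 (Set.projIcc 0 1 zero_le_one t)) := by
    rw [unitInterval.primitive_apply]
    exact intervalIntegral.integral_congr fun t _ => hNX _ hvr _
  rw [← this]
  rfl

/-- The integral equation of the flow of an analytic vector field has a local solution that is
jointly analytic in time and initial value. -/
theorem AnalyticAt.exists_analytic_integral_flow [CompleteSpace E] {X : E → E} (hX : AnalyticAt ℝ X 0) :
    ∃ Y : ℝ × E → E, AnalyticAt ℝ Y 0 ∧ Y 0 = 0 ∧
      ∀ᶠ z : ℝ × E in 𝓝 0, Y z = z.2 + ∫ t in (0 : ℝ)..z.1, X (Y (t, z.2)) := by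
  obtain ⟨ψ, hψ, hψ0, hsol⟩ := hX.exists_analytic_integral_curve
  obtain ⟨ε, hε, hball⟩ := Metric.eventually_nhds_iff_ball.1 hsol
  have hsmall : ∀ᶠ z in 𝓝 (0 : ℝ × E), ‖ψ z‖ < ε := by
    have := hψ.continuousAt.norm.tendsto
    rw [hψ0, norm_zero] at this
    exact this.eventually (gt_mem_nhds hε)
  refine ⟨fun z => ψ z 1, ((ContinuousMap.evalCLM ℝ (1 : unitInterval) : C(unitInterval, E) →L[ℝ] E).analyticAt _).comp hψ,
    by simp [hψ0], ?_⟩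
  filter_upwards [hsmall, Metric.ball_mem_nhds _ hε] with z hz hzε
  have hz1 : |z.1| < ε := (norm_fst_le z).trans_lt (by simpa using hzε)
  have hz2 : ‖z.2‖ < ε := (norm_snd_le z).trans_lt (by simpa using hzε)
  have hγ := (hball (z, ψ z) (by simp_all [Prod.norm_def])).2 rfl
  -- The initial piece of a solution, reparametrized to [0,1], solves the equation with time scaled
  -- by `s`; uniqueness identifies the two.
  have hscale : ∀ s : unitInterval, ψ (z.1 * s, z.2) 1 = ψ z s := by
    intro s
    let γ : C(unitInterval, E) := ⟨fun t => ψ z (s * t), by fun_prop⟩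
    have hγn : ‖γ‖ < ε := lt_of_le_of_lt
      ((ContinuousMap.norm_le _ (by positivity)).2 fun t => (ψ z).norm_coe_le_norm _) hz
    have hs1 : |z.1 * s| < ε := by
      rw [abs_mul, abs_of_nonneg s.2.1]
      exact lt_of_le_of_lt (mul_le_of_le_one_right (abs_nonneg _) s.2.2) hz1
    have key := (hball ((z.1 * s, z.2), γ) (by simp_all [Prod.norm_def])).1 (by
      intro t
      have h1 := hγ (s * t)
      change ψ z (s * t) = z.2 + (z.1 * s) • ∫ r in (0 : ℝ)..t,
        X (ψ z (s * Set.projIcc 0 1 zero_le_one r))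
      rw [h1, mul_smul]
      congr 2
      have h2 := intervalIntegral.smul_integral_comp_mul_left
        (a := 0) (b := (t : ℝ)) (fun r => X (ψ z (Set.projIcc 0 1 zero_le_one r))) (s : ℝ)
      rw [mul_zero] at h2
      refine h2.symm.trans ?_
      congr 1
      refine intervalIntegral.integral_congr fun r hr => ?_
      rw [Set.uIcc_of_le t.2.1] at hr
      have hr' : r ∈ unitInterval := ⟨hr.1, hr.2.trans t.2.2⟩
      have hsr : (s : ℝ) * r ∈ unitInterval := unitInterval.mul_mem s.2 hr'
      change X (ψ z _) = X (ψ z _)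
      rw [Set.projIcc_of_mem _ hr', Set.projIcc_of_mem _ hsr]
      rfl)
    change ψ (z.1 * s, z.2) = γ at key
    rw [key]
    simp [γ]
  have h1 := hγ 1
  change ψ z 1 = z.2 + z.1 • ∫ t in (0 : ℝ)..(1 : ℝ), X (ψ z (Set.projIcc 0 1 zero_le_one t)) at h1
  have h2 := intervalIntegral.smul_integral_comp_mul_left
    (a := 0) (b := (1 : ℝ)) (fun r => X (ψ (r, z.2) 1)) z.1
  rw [mul_zero, mul_one] at h2
  change ψ z 1 = _
  rw [h1, ← h2]
  congr 2
  refine intervalIntegral.integral_congr fun r hr => ?_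
  rw [Set.uIcc_of_le zero_le_one] at hr
  rw [Set.projIcc_of_mem _ hr, ← hscale]

end

/-! ### Flow, straightening and analytic inverse function -/

section

variable {E : Type*} [NormedAddCommGroup E] [NormedSpace ℝ E]

/-- The local flow of an analytic vector field is jointly analytic in time and initial value.
A linear form that is identically `1` on the vector field grows along the flow at unit speed. -/
theorem AnalyticAt.exists_analytic_flow [CompleteSpace E] {X : E → E} (hX : AnalyticAt ℝ X 0)
    (ℓ : E →L[ℝ] ℝ) (hℓ : ∀ x, ℓ (X x) = 1) :
    ∃ Y : ℝ × E → E, AnalyticAt ℝ Y 0 ∧ Y 0 = 0 ∧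
      ∀ᶠ z : ℝ × E in 𝓝 0, Y (0, z.2) = z.2 ∧
        HasDerivAt (fun t => Y (t, z.2)) (X (Y z)) z.1 ∧ ℓ (Y z) = ℓ z.2 + z.1 := by
  obtain ⟨Y, hY, hY0, hint⟩ := hX.exists_analytic_integral_flow
  refine ⟨Y, hY, hY0, ?_⟩
  have hXY : ∀ᶠ z in 𝓝 (0 : ℝ × E), ContinuousAt (fun z => X (Y z)) z :=
    (AnalyticAt.comp (g := X) (by rwa [hY0]) hY).eventually_analyticAt.mono
      fun z hz => hz.continuousAt
  obtain ⟨ε, hε, hball⟩ := Metric.eventually_nhds_iff_ball.1 (hint.and hXY)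
  filter_upwards [Metric.ball_mem_nhds _ hε] with z hz
  have hz1 : |z.1| < ε := (norm_fst_le z).trans_lt (by simpa using hz)
  have hz2 : ‖z.2‖ < ε := (norm_snd_le z).trans_lt (by simpa using hz)
  have hmem : ∀ t ∈ Metric.ball (0 : ℝ) ε, (t, z.2) ∈ Metric.ball (0 : ℝ × E) ε := by
    intro t ht
    simp_all [Prod.norm_def]
  have hcont : ContinuousOn (fun t => X (Y (t, z.2))) (Metric.ball 0 ε) := fun t ht =>
    (ContinuousAt.comp (f := fun t => (t, z.2)) (hball _ (hmem t ht)).2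
      (by fun_prop)).continuousWithinAt
  have hz1' : z.1 ∈ Metric.ball (0 : ℝ) ε := by simpa using hz1
  have hintble : IntervalIntegrable (fun t => X (Y (t, z.2))) MeasureTheory.volume 0 z.1 :=
    (hcont.mono ((convex_ball (0 : ℝ) ε).ordConnected.uIcc_subset
      (Metric.mem_ball_self hε) hz1')).intervalIntegrable
  refine ⟨?_, ?_, ?_⟩
  · simpa using (hball _ (hmem 0 (Metric.mem_ball_self hε))).1
  · have h1 := (intervalIntegral.integral_hasDerivAt_right hintble
      (hcont.stronglyMeasurableAtFilter Metric.isOpen_ball _ hz1')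
      (hcont.continuousAt (Metric.isOpen_ball.mem_nhds hz1'))).const_add z.2
    refine h1.congr_of_eventuallyEq ?_
    filter_upwards [Metric.isOpen_ball.mem_nhds hz1'] with t ht
    exact (hball _ (hmem t ht)).1
  · rw [(hball z hz).1, map_add, ← ℓ.intervalIntegral_comp_comm hintble]
    simp [hℓ]

/-- Straightening of an analytic vector field that is transverse to the level sets of a linear
form `ℓ`, by a map that preserves `ℓ`. -/
theorem AnalyticAt.exists_straightening [CompleteSpace E] {X : E → E} (hX : AnalyticAt ℝ X 0)
    (ℓ : E →L[ℝ] ℝ) (hℓ : ∀ x, ℓ (X x) = 1) {e : E} (he : ℓ e = 1) :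
    ∃ Φ : E → E, AnalyticAt ℝ Φ 0 ∧ Φ 0 = 0 ∧ Function.Injective (fderiv ℝ Φ 0) ∧
      ∀ᶠ x in 𝓝 0, ℓ (Φ x) = ℓ x ∧ fderiv ℝ Φ x e = X (Φ x) := by
  obtain ⟨Y, hY, hY0, hflow⟩ := hX.exists_analytic_flow ℓ hℓ
  -- Splits x into the flow time ℓ x and a starting point in ker ℓ.
  let L : E →L[ℝ] ℝ × E := ℓ.prod (.id ℝ E - ℓ.smulRight e)
  have hL : ∀ x, L x = (ℓ x, x - ℓ x • e) := fun x => rfl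
  have hLt : Filter.Tendsto L (𝓝 0) (𝓝 0) := L.continuous.tendsto' _ _ (map_zero L)
  have hΦ : AnalyticAt ℝ (fun x => Y (L x)) 0 :=
    AnalyticAt.comp (g := Y) (by rwa [map_zero]) (L.analyticAt 0)
  have hℓΦ : ∀ᶠ x in 𝓝 0, ℓ (Y (L x)) = ℓ x := by
    filter_upwards [hLt.eventually hflow] with x hx
    rw [hx.2.2, hL]
    simp [he]
  refine ⟨fun x => Y (L x), hΦ, by simp [hY0], ?_, ?_⟩
  · refine (injective_iff_map_eq_zero _).2 fun v hv => ?_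
    have hd := hΦ.differentiableAt.hasFDerivAt
    have hv0 : ℓ v = 0 := by
      have h1 : HasFDerivAt (fun x => ℓ (Y (L x))) ℓ 0 :=
        ℓ.hasFDerivAt.congr_of_eventuallyEq hℓΦ
      rw [(h1.unique (ℓ.hasFDerivAt.comp 0 hd) :)]
      simp [hv]
    have h2 : HasDerivAt (fun t : ℝ => t • v) v 0 := by
      simpa using (hasDerivAt_id (0 : ℝ)).smul_const v
    have h3 : HasDerivAt (fun t : ℝ => Y (L (t • v))) (fderiv ℝ (fun x => Y (L x)) 0 v) 0 :=
      HasFDerivAt.comp_hasDerivAt (l := fun x => Y (L x)) (0 : ℝ)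
        (by simpa using hd) h2
    -- On ker ℓ the flow time is 0, so Φ is the identity there.
    have h4 : (fun t : ℝ => Y (L (t • v))) =ᶠ[𝓝 0] fun t => t • v := by
      have ht : Filter.Tendsto (fun t : ℝ => L (t • v)) (𝓝 0) (𝓝 0) :=
        (by fun_prop : Continuous fun t : ℝ => L (t • v)).tendsto' _ _ (by simp)
      filter_upwards [ht.eventually hflow] with t ht
      simpa [hL, hv0] using ht.1
    rw [← hv]
    exact h2.unique (h3.congr_of_eventuallyEq h4.symm)
  · filter_upwards [hℓΦ, hLt.eventually hflow, hΦ.eventually_analyticAt] with x hx hfx hax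
    refine ⟨hx, ?_⟩
    have h2 : HasDerivAt (fun t : ℝ => x + (t - ℓ x) • e) e (ℓ x) := by
      simpa using (((hasDerivAt_id (ℓ x)).sub_const (ℓ x)).smul_const e).const_add x
    have h3 : HasDerivAt (fun t : ℝ => Y (L (x + (t - ℓ x) • e)))
        (fderiv ℝ (fun x => Y (L x)) x e) (ℓ x) :=
      HasFDerivAt.comp_hasDerivAt (l := fun x => Y (L x)) (ℓ x)
        (by simpa using hax.differentiableAt.hasFDerivAt) h2
    have h4 : ∀ t : ℝ, L (x + (t - ℓ x) • e) = (t, (L x).2) := by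
      intro t
      simp only [hL, map_add, map_smul, he, smul_eq_mul, mul_one, Prod.mk.injEq]
      refine ⟨by ring, ?_⟩
      module
    simp only [h4] at h3
    exact h3.unique hfx.2.1

/-- The analytic inverse function theorem in finite dimension, with the domain shrunk so that a
given property holds on it. -/
theorem AnalyticAt.exists_openPartialHomeomorph [FiniteDimensional ℝ E] {Φ : E → E} {a : E}
    (hΦ : AnalyticAt ℝ Φ a) (hinj : Function.Injective (fderiv ℝ Φ a)) {P : E → Prop}
    (hP : ∀ᶠ x in 𝓝 a, P x) :
    ∃ e : OpenPartialHomeomorph E E, ⇑e = Φ ∧ a ∈ e.source ∧ AnalyticOnNhd ℝ e e.source ∧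
      AnalyticOnNhd ℝ e.symm e.target ∧ ∀ x ∈ e.source, P x := by
  have : CompleteSpace E := FiniteDimensional.complete ℝ E
  let D : E ≃L[ℝ] E := (LinearEquiv.ofInjectiveEndo
    (fderiv ℝ Φ a : E →ₗ[ℝ] E) hinj).toContinuousLinearEquiv
  have hD : HasFDerivAt Φ (D : E →L[ℝ] E) a := by
    have : (D : E →L[ℝ] E) = fderiv ℝ Φ a := by ext; rfl
    rw [this]
    exact hΦ.differentiableAt.hasFDerivAt
  -- In `WithTop ℕ∞` the top element means analytic, so the local inverse is analytic too.
  have hcd : ContDiffAt ℝ ⊤ Φ a := hΦ.contDiffAt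
  have hn : (⊤ : WithTop ℕ∞) ≠ 0 := by simp
  let e := hcd.toOpenPartialHomeomorph Φ hD hn
  have ha : a ∈ e.source := hcd.mem_toOpenPartialHomeomorph_source hD hn
  have hsymm : AnalyticAt ℝ e.symm (e a) := (hcd.to_localInverse hD hn).analyticAt
  have hev : ∀ᶠ x in 𝓝 a, AnalyticAt ℝ Φ x ∧ AnalyticAt ℝ e.symm (e x) ∧ P x :=
    hΦ.eventually_analyticAt.and
      (((e.continuousAt ha).eventually hsymm.eventually_analyticAt).and hP)
  let S : Set E := {x | AnalyticAt ℝ Φ x ∧ AnalyticAt ℝ e.symm (e x) ∧ P x}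
  have hsrc : ∀ x ∈ (e.restr S).source, x ∈ S := by
    intro x hx
    rw [OpenPartialHomeomorph.restr_source] at hx
    exact interior_subset hx.2
  refine ⟨e.restr S, rfl, ?_,
    fun x hx => (hsrc x hx).1, fun y hy => ?_, fun x hx => (hsrc x hx).2.2⟩
  · rw [OpenPartialHomeomorph.restr_source]
    exact ⟨ha, mem_interior_iff_mem_nhds.2 hev⟩
  · have h1 := (hsrc _ (OpenPartialHomeomorph.map_target _ hy)).2.1
    have h2 := OpenPartialHomeomorph.right_inv _ hy
    change e (e.symm y) = y at h2
    change AnalyticAt ℝ e.symm (e (e.symm y)) at h1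
    rw [h2] at h1
    exact h1

theorem AnalyticAt.matrix_det {n : Type*} [Fintype n] [DecidableEq n] {A : E → Matrix n n ℝ}
    {x : E} (hA : ∀ i j, AnalyticAt ℝ (fun y => A y i j) x) :
    AnalyticAt ℝ (fun y => (A y).det) x := by
  simp only [Matrix.det_apply']
  exact Finset.analyticAt_fun_sum _ fun σ _ =>
    analyticAt_const.mul (Finset.analyticAt_fun_prod _ fun i _ => hA _ _)

end

/-! ### The orthogonal vector field and the cross terms -/

/-- The vector with last component `1` that is orthogonal, with respect to `G`, to the first
coordinate directions. -/
noncomputable def conormalVector {m : ℕ} (G : Matrix (Fin (m + 1)) (Fin (m + 1)) ℝ) :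
    Fin (m + 1) → ℝ :=
  Fin.snoc (α := fun _ => ℝ) (fun j => -((tangentialBlock G).cramer
    (fun k => G k.castSucc (Fin.last m)) j * (tangentialBlock G).det⁻¹)) 1

theorem conormalVector_last {m : ℕ} (G : Matrix (Fin (m + 1)) (Fin (m + 1)) ℝ) :
    conormalVector G (Fin.last m) = 1 := by
  simp [conormalVector]

theorem mulVec_conormalVector {m : ℕ} {G : Matrix (Fin (m + 1)) (Fin (m + 1)) ℝ}
    (hG : (tangentialBlock G).det ≠ 0) (k : Fin m) :
    (G *ᵥ conormalVector G) k.castSucc = 0 := by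
  have h := congrFun (Matrix.mulVec_cramer (tangentialBlock G)
    (fun k => G k.castSucc (Fin.last m))) k
  simp only [Matrix.mulVec, dotProduct, Pi.smul_apply, smul_eq_mul] at h
  simp only [Matrix.mulVec, dotProduct, Fin.sum_univ_castSucc, conormalVector, Fin.snoc_castSucc,
    Fin.snoc_last, mul_neg, mul_one, ← mul_assoc, Finset.sum_neg_distrib, ← Finset.sum_mul]
  have h' : ∑ i : Fin m, G k.castSucc i.castSucc * (tangentialBlock G).cramer
      (fun k => G k.castSucc (Fin.last m)) i
        = (tangentialBlock G).det * G k.castSucc (Fin.last m) := h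
  rw [h']
  field_simp
  ring

theorem AnalyticAt.conormalVector {m : ℕ} {E : Type*} [NormedAddCommGroup E] [NormedSpace ℝ E]
    {g : E → Matrix (Fin (m + 1)) (Fin (m + 1)) ℝ} {x : E}
    (hg : ∀ α β, AnalyticAt ℝ (fun y => g y α β) x) (hdet : (tangentialBlock (g x)).det ≠ 0) :
    AnalyticAt ℝ (fun y => conormalVector (g y)) x := by
  refine analyticAt_pi_iff.2 fun i => ?_
  refine Fin.lastCases ?_ (fun j => ?_) i
  · simp only [conormalVector_last]
    exact analyticAt_const
  · simp only [_root_.conormalVector, Fin.snoc_castSucc, Matrix.cramer_apply]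
    refine ((AnalyticAt.matrix_det fun k l => ?_).mul
      ((AnalyticAt.matrix_det fun k l => hg _ _).inv hdet)).neg
    simp only [Matrix.updateCol_apply]
    split_ifs
    · exact hg _ _
    · exact hg _ _

/-- The last column of `G * J` vanishes except in its last entry, which meets only the zero entry of
each other column of `J`. Symmetry gives the transposed entries. -/
theorem hasNoCrossTerms_transpose_mul_mul {m : ℕ}
    {G J : Matrix (Fin (m + 1)) (Fin (m + 1)) ℝ} (hG : G.IsSymm)
    (hdet : (tangentialBlock G).det ≠ 0) (hlast : ∀ α, J α (Fin.last m) = conormalVector G α)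
    (hJ : ∀ k : Fin m, J (Fin.last m) k.castSucc = 0) : HasNoCrossTerms (Jᵀ * G * J) := by
  have hsymm : (Jᵀ * G * J)ᵀ = Jᵀ * G * J := by
    simp [Matrix.transpose_mul, hG.eq, Matrix.mul_assoc]
  have h : ∀ k : Fin m, (Jᵀ * G * J) k.castSucc (Fin.last m) = 0 := by
    intro k
    have hcol : ∀ α, (G * J) α (Fin.last m) = (G *ᵥ conormalVector G) α := by
      intro α
      simp [Matrix.mul_apply, Matrix.mulVec, dotProduct, hlast]
    rw [Matrix.mul_assoc, Matrix.mul_apply, Fin.sum_univ_castSucc]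
    simp [hcol, mulVec_conormalVector hdet, hJ]
  intro k
  refine ⟨h k, ?_⟩
  rw [← hsymm, Matrix.transpose_apply, h k]

theorem proposition2p1 (m : ℕ) (U : Set (Fin (m + 1) → ℝ)) (hU : IsOpen U)
    (h0 : (0 : Fin (m + 1) → ℝ) ∈ U) (g : TensorField m)
    (hg : IsSingularRiemannianMetric U g) :
    ∃ (Φ : OpenPartialHomeomorph (Fin (m + 1) → ℝ) (Fin (m + 1) → ℝ))
      (f : (Fin (m + 1) → ℝ) → (Fin m → ℝ)),
      (0 : Fin (m + 1) → ℝ) ∈ Φ.source ∧ Φ 0 = 0 ∧ Φ.target ⊆ U ∧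
      AnalyticOnNhd ℝ f Φ.source ∧
      AnalyticOnNhd ℝ Φ Φ.source ∧ AnalyticOnNhd ℝ Φ.symm Φ.target ∧
      (∀ x ∈ Φ.source, Φ x (Fin.last m) = x (Fin.last m) ∧
        ∀ j : Fin m, Φ x j.castSucc = x j.castSucc + f x j) ∧
      ∀ x ∈ Φ.source, HasNoCrossTerms (pullbackTensor Φ g x) := by
  let ℓ : (Fin (m + 1) → ℝ) →L[ℝ] ℝ := .proj (Fin.last m)
  have hX : AnalyticAt ℝ (fun x => conormalVector (g x)) 0 :=
    AnalyticAt.conormalVector (fun α β => hg.analytic α β 0 h0) (hg.det_ne_zero 0 h0)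
  obtain ⟨Φ, hΦ, hΦ0, hinj, hev⟩ := hX.exists_straightening ℓ
    (fun x => conormalVector_last (g x)) (e := Pi.single (Fin.last m) 1) (by simp [ℓ])
  have hΦU : ∀ᶠ x in 𝓝 0, Φ x ∈ U :=
    hΦ.continuousAt.eventually (hU.mem_nhds (by rwa [hΦ0]))
  obtain ⟨e, rfl, he0, hean, hesymm, hP⟩ := hΦ.exists_openPartialHomeomorph hinj (hΦU.and hev)
  refine ⟨e, fun x j => e x j.castSucc - x j.castSucc, he0, hΦ0, fun y hy => ?_, fun x hx => ?_,
    hean, hesymm, fun x hx => ⟨(hP x hx).2.1, fun j => by ring⟩, fun x hx => ?_⟩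
  · have := (hP _ (e.map_target hy)).1
    rwa [e.right_inv hy] at this
  · refine analyticAt_pi_iff.2 fun j => ?_
    exact (analyticAt_pi_iff.1 (hean x hx) j.castSucc).sub
      ((ContinuousLinearMap.proj (R := ℝ) (φ := fun _ : Fin (m + 1) => ℝ) j.castSucc).analyticAt x)
  · obtain ⟨hxU, -, hfd⟩ := hP x hx
    have hsymm : (g (e x)).IsSymm := by
      have := (hg.posSemidef _ hxU).isHermitian
      rwa [Matrix.IsHermitian, Matrix.conjTranspose_eq_transpose_of_trivial] at this
    refine hasNoCrossTerms_transpose_mul_mul hsymm (hg.det_ne_zero _ hxU)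
      (fun α => congrFun hfd α) fun k => ?_
    -- Differentiating the invariance of x_n shows that the last row of the Jacobian is that of the
    -- identity.
    have h1 : HasFDerivAt (fun y => ℓ (e y)) ℓ x :=
      ℓ.hasFDerivAt.congr_of_eventuallyEq <| by
        filter_upwards [e.open_source.mem_nhds hx] with y hy using (hP y hy).2.1
    have h2 := h1.unique (ℓ.hasFDerivAt.comp x (hean x hx).differentiableAt.hasFDerivAt)
    have h3 := DFunLike.congr_fun h2 (Pi.single k.castSucc 1)
    have h4 : ℓ (Pi.single k.castSucc 1) = 0 := by
      simp [ℓ, (Fin.castSucc_lt_last k).ne']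
    exact h3.symm.trans h4
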